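/- **Theorem 4.1.** Let $(X,\mu)$ be a non-atomic probability space. A set $\mathcal T$ of measurable subsets of $X$ is a *tree* if: $X\in\mathcal T$ and $\mu(I)>0$ for all $I\in\mathcal T$; to every $I\in\mathcal T$ there corresponds a finite or countable set $C(I)\subseteq\mathcal T$ with at least two elements, which are subsets of $I$ with pairwise intersections of measure $0$ and with union $I$; $\mathcal T=\bigcup_{m\ge0}\mathcal T_{(m)}$, where $\mathcal T_{(0)}=\{X\}$ and $\mathcal T_{(m+1)}=\bigcup_{I\in\mathcal T_{(m)}}C(I)$; and $\lim_{m\to\infty}\sup_{I\in\mathcal T_{(m)}}\mu(I)=0$. Fix a tree $\mathcal T$ and put $$\mathcal M\varphi(x)=\sup\Big\{\tfrac1{\mu(I)}\int_I|\varphi|\,d\mu:\ x\in I\in\mathcal T\Big\},$$ $$|||\varphi|||_{p,\infty}=\sup\Big\{\mu(E)^{-1+\frac1p}\int_E|\varphi|\,d\mu:\ E\subseteq X\text{ measurable},\ \mu(E)>0\Big\}.$$ Let $1<q<p$, let $\Gamma=\big(\frac{p-1}{p}\big)^q\frac{p}{p-q}$, and let $f,A$ be real numbers with $$0<f\le1,\qquad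 f^q\le A\le\Gamma f^{\frac{p-q}{p-1}}.$$ For $\lambda>0$ let $$G_{f,A}(\lambda)=\sup\Big\{\mu(\{\mathcal M\varphi\ge\lambda\}):\ \varphi\ge0\text{ measurable},\ \int_X\varphi\,d\mu=f,\ \int_X\varphi^q\,d\mu=A\Big\},$$ $$T^{(1)}_{f,A}(\lambda)=\sup\Big\{\mu(\{\mathcal M\varphi\ge\lambda\}):\ \varphi\ge0\text{ measurable},\ \int_X\varphi\,d\mu=f,\ \int_X\varphi^q\,d\mu=A,\ |||\varphi|||_{p,\infty}\le1\Big\}.$$ Then for every $\lambda>0$ $$T^{(1)}_{f,A}(\lambda)=\min\Big\{1,\ G_{f,A}(\lambda),\ \frac1{\lambda^p}\Big\}.$$ -/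

import Mathlib

open MeasureTheory Filter Topology
open scoped ENNReal

namespace DyadicMaximal

variable {X : Type*} [MeasurableSpace X]

/-- A measure is non-atomic if every measurable set of positive measure contains a measurable
subset of strictly smaller positive measure. (`MeasureTheory.NullSingletonClass` is weaker, as it
only speaks about singletons.) -/
def IsNonatomic (μ : Measure X) : Prop :=
  ∀ s : Set X, MeasurableSet s → 0 < μ s → ∃ t ⊆ s, MeasurableSet t ∧ 0 < μ t ∧ μ t < μ s

/-- The levels generated by a "children" map `C`: level `0` is `{X}`, and level `m + 1`
consists of all children of the elements of level `m`. -/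
def treeLevel (C : Set X → Set (Set X)) : ℕ → Set (Set X)
  | 0 => {Set.univ}
  | m + 1 => ⋃ I ∈ treeLevel C m, C I

/-- `T` is a tree on `(X, μ)` with children map `C` (only the values of `C` on `T` matter). -/
structure IsTreeWith (μ : Measure X) (T : Set (Set X)) (C : Set X → Set (Set X)) : Prop where
  measurableSet : ∀ I ∈ T, MeasurableSet I
  univ_mem : Set.univ ∈ T
  measure_pos : ∀ I ∈ T, 0 < μ I
  children_subset : ∀ I ∈ T, C I ⊆ T
  children_countable : ∀ I ∈ T, (C I).Countable
  children_nontrivial : ∀ I ∈ T, (C I).Nontrivial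
  children_almost_disjoint : ∀ I ∈ T, (C I).Pairwise fun J K => μ (J ∩ K) = 0
  sUnion_children : ∀ I ∈ T, ⋃₀ C I = I
  eq_iUnion_level : T = ⋃ m, treeLevel C m
  tendsto_level : Tendsto (fun m => ⨆ I ∈ treeLevel C m, μ I) atTop (𝓝 0)

/-- A set `T` of measurable subsets of `X` is a tree. -/
def IsTree (μ : Measure X) (T : Set (Set X)) : Prop :=
  ∃ C : Set X → Set (Set X), IsTreeWith μ T C

/-- The maximal operator of the tree `T`; its values may be `∞`. -/
noncomputable def maximalOp (μ : Measure X) (T : Set (Set X)) (φ : X → ℝ) (x : X) : ℝ≥0∞ :=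
  ⨆ (I : Set X) (_ : I ∈ T) (_ : x ∈ I), (∫⁻ y in I, ‖φ y‖ₑ ∂μ) / μ I

/-- The norm `|||φ|||_{p,∞}`, the supremum of `μ(E)^(-1+1/p) ∫_E |φ|` over the measurable sets `E`
of positive measure. -/
noncomputable def weakNorm (μ : Measure X) (p : ℝ) (φ : X → ℝ) : ℝ≥0∞ :=
  ⨆ (E : Set X) (_ : MeasurableSet E) (_ : 0 < μ E),
    μ E ^ (-1 + 1 / p) * ∫⁻ y in E, ‖φ y‖ₑ ∂μ

/-- `φ` is measurable, nonnegative, `∫ φ = f` and `∫ φ^q = A`. -/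
structure HasMoments (μ : Measure X) (q f A : ℝ) (φ : X → ℝ) : Prop where
  measurable : Measurable φ
  nonneg : ∀ x, 0 ≤ φ x
  integrable : Integrable φ μ
  integral_eq : ∫ x, φ x ∂μ = f
  integrable_rpow : Integrable (fun x => φ x ^ q) μ
  integral_rpow_eq : ∫ x, φ x ^ q ∂μ = A

/-- `G_{f,A}(lam)`: the supremum of `μ {Mφ ≥ lam}` under the constraints on `∫ φ` and `∫ φ^q`. -/
noncomputable def supG (μ : Measure X) (T : Set (Set X)) (q f A lam : ℝ) : ℝ≥0∞ :=
  ⨆ (φ : X → ℝ) (_ : HasMoments μ q f A φ), μ {x | ENNReal.ofReal lam ≤ maximalOp μ T φ x}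

/-- `T^{(1)}_{f,A}(lam)`: the supremum of `μ {Mφ ≥ lam}` under the constraints on `∫ φ` and
`∫ φ^q`, and `|||φ|||_{p,∞} ≤ 1`. -/
noncomputable def supT (μ : Measure X) (T : Set (Set X)) (p q f A lam : ℝ) : ℝ≥0∞ :=
  ⨆ (φ : X → ℝ) (_ : HasMoments μ q f A φ) (_ : weakNorm μ p φ ≤ 1),
    μ {x | ENNReal.ofReal lam ≤ maximalOp μ T φ x}

/-- The constant `Γ = ((p-1)/p)^q * p/(p-q)`. -/
noncomputable def gammaConst (p q : ℝ) : ℝ := ((p - 1) / p) ^ q * (p / (p - q))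

/-- The domain `D` of the extremal problem. -/
def domainD (p q : ℝ) : Set (ℝ × ℝ) :=
  {z | 0 < z.1 ∧ z.1 ≤ 1 ∧ z.1 ^ q ≤ z.2 ∧ z.2 ≤ gammaConst p q * z.1 ^ ((p - q) / (p - 1))}

end DyadicMaximal

/-! Upper bound. Dropping the norm constraint leaves `supG`. If E = {Mφ ≥ λ}, the weak type
inequality λ μ(E) ≤ ∫_E φ and the norm bound ∫_E φ ≤ μ(E)^(1-1/p) together give μ(E) ≤ λ^(-p).

Lower bound for λ > f. Take φ admissible for `supG`, E = {Mφ ≥ λ}, and c < min(μ(E), λ^(-p)). The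
tree contains an almost disjoint family S whose union has measure k with c < k ≤ min(μ(E), λ^(-p)).
The function of mean f equal to λ on ⋃S and to a constant elsewhere has average λ on each member of
S. By convexity of t^q its q-th moment is at most A (`HasMoments.twoValued_rpow_le`), and k λ^p ≤ 1
keeps its norm at most 1.

Its q-th moment may be too small. This is repaired by moving along a segment towards a rearrangement
of the truncated power (1-1/p) t^(-1/p), which has mean f, norm at most 1 and q-th moment Γ
f^((p-q)/(p-1)) ≥ A. The rearrangement is chosen evenly spread over S (`exists_uniform_on_family`),
so that its averages there are also at least λ. Mean, norm bound and averages survive convex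
combinations, and the q-th moment varies continuously, hence takes the value A. For λ ≤ f the same
argument runs with S = {X} and the constant f. -/

namespace DyadicMaximal

variable {X : Type*} [MeasurableSpace X]

/-! ### Levels of a tree and almost disjoint subfamilies -/

namespace IsTreeWith

variable {μ : Measure X} {T : Set (Set X)} {C : Set X → Set (Set X)}

theorem level_subset (h : IsTreeWith μ T C) (m : ℕ) : treeLevel C m ⊆ T := by
  rw [h.eq_iUnion_level]
  exact Set.subset_iUnion (treeLevel C) m

theorem level_countable (h : IsTreeWith μ T C) (m : ℕ) : (treeLevel C m).Countable := by
  induction m with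
  | zero => exact Set.countable_singleton _
  | succ m ih =>
    exact ih.biUnion fun I hI => h.children_countable I (h.level_subset m hI)

theorem countable (h : IsTreeWith μ T C) : T.Countable := by
  rw [h.eq_iUnion_level]
  exact Set.countable_iUnion h.level_countable

theorem level_pairwise (h : IsTreeWith μ T C) (m : ℕ) :
    (treeLevel C m).Pairwise (AEDisjoint μ) := by
  induction m with
  | zero => exact Set.pairwise_singleton _ _
  | succ m ih =>
    intro I hI I' hI' hne
    simp only [treeLevel, Set.mem_iUnion] at hI hI'
    obtain ⟨J, hJ, hIJ⟩ := hI
    obtain ⟨J', hJ', hIJ'⟩ := hI'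
    have sub : ∀ {K L : Set X}, K ∈ treeLevel C m → L ∈ C K → L ⊆ K := fun {K L} hK hL => by
      rw [← h.sUnion_children K (h.level_subset m hK)]
      exact Set.subset_sUnion_of_mem hL
    by_cases hJJ : J = J'
    · subst hJJ
      exact h.children_almost_disjoint J (h.level_subset m hJ) hIJ hIJ' hne
    · exact (ih hJ hJ' hJJ).mono (sub hJ hIJ) (sub hJ' hIJ')

theorem level_sUnion (h : IsTreeWith μ T C) (m : ℕ) : ⋃₀ treeLevel C m = Set.univ := by
  induction m with
  | zero => simp [treeLevel]
  | succ m ih =>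
    rw [Set.eq_univ_iff_forall] at ih ⊢
    intro x
    obtain ⟨J, hJ, hx⟩ := ih x
    rw [← h.sUnion_children J (h.level_subset m hJ)] at hx
    obtain ⟨I, hI, hx⟩ := hx
    exact ⟨I, Set.mem_biUnion hJ hI, hx⟩

theorem exists_ancestor (h : IsTreeWith μ T C) {i m : ℕ} (him : i ≤ m) {I : Set X}
    (hI : I ∈ treeLevel C m) : ∃ J ∈ treeLevel C i, I ⊆ J := by
  induction m, him using Nat.le_induction generalizing I with
  | base => exact ⟨I, hI, subset_rfl⟩
  | succ m _ ih =>
    simp only [treeLevel, Set.mem_iUnion] at hI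
    obtain ⟨K, hK, hIK⟩ := hI
    obtain ⟨J, hJ, hKJ⟩ := ih hK
    refine ⟨J, hJ, subset_trans ?_ hKJ⟩
    rw [← h.sUnion_children K (h.level_subset m hK)]
    exact Set.subset_sUnion_of_mem hIK

/-- Every subfamily of a tree has an almost disjoint subfamily with the same union. -/
theorem exists_aedisjoint_subfamily (h : IsTreeWith μ T C) {S : Set (Set X)} (hS : S ⊆ T) :
    ∃ S' ⊆ S, S'.Pairwise (AEDisjoint μ) ∧ ⋃₀ S' = ⋃₀ S := by
  let B : ℕ → Set X := fun m => ⋃₀ (S ∩ treeLevel C m)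
  -- If the level-`i` ancestor of `I` belongs to `S`, it is part of `B i`; otherwise it meets each
  -- of the countably many sets forming `B i` in a null set.
  have dich : ∀ {i m : ℕ}, i < m → ∀ {I}, I ∈ treeLevel C m → I ⊆ B i ∨ AEDisjoint μ I (B i) := by
    intro i m him I hI
    obtain ⟨J, hJ, hIJ⟩ := h.exists_ancestor him.le hI
    by_cases hJS : J ∈ S
    · exact Or.inl (hIJ.trans (Set.subset_sUnion_of_mem ⟨hJS, hJ⟩))
    · right
      have : AEDisjoint μ I (⋃ K ∈ S ∩ treeLevel C i, K) := by
        rw [AEDisjoint, Set.inter_iUnion₂,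
          measure_biUnion_null_iff ((h.level_countable i).mono Set.inter_subset_right)]
        intro K hK
        have hne : J ≠ K := fun e => hJS (e ▸ hK.1)
        exact ((h.level_pairwise i hJ hK.2 hne).mono hIJ subset_rfl)
      simpa only [B, Set.sUnion_eq_biUnion] using this
  -- The maximal members of `S`, up to null sets: those almost disjoint from everything selected on
  -- coarser levels.
  refine ⟨{I | I ∈ S ∧ ∃ m, I ∈ treeLevel C m ∧ ∀ i < m, AEDisjoint μ I (B i)},
    fun I hI => hI.1, ?_, ?_⟩
  · rintro I ⟨hIS, m, hIm, hI⟩ J ⟨hJS, n, hJn, hJ⟩ hne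
    rcases lt_trichotomy m n with hmn | rfl | hmn
    · exact ((hJ m hmn).mono subset_rfl (Set.subset_sUnion_of_mem ⟨hIS, hIm⟩)).symm
    · exact h.level_pairwise m hIm hJn hne
    · exact (hI n hmn).mono subset_rfl (Set.subset_sUnion_of_mem ⟨hJS, hJn⟩)
  · refine subset_antisymm (Set.sUnion_subset_sUnion fun I hI => hI.1) ?_
    rintro x ⟨I, hIS, hxI⟩
    have hex : ∃ m, x ∈ B m := by
      have hIT := hS hIS
      rw [h.eq_iUnion_level, Set.mem_iUnion] at hIT
      obtain ⟨m, hm⟩ := hIT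
      exact ⟨m, I, ⟨hIS, hm⟩, hxI⟩
    classical
    obtain ⟨J, ⟨hJS, hJm⟩, hxJ⟩ := Nat.find_spec hex
    refine ⟨J, ⟨hJS, Nat.find hex, hJm, fun i hi => ?_⟩, hxJ⟩
    exact (dich hi hJm).resolve_left fun hsub => Nat.find_min hex hi (hsub hxJ)

/-! ### The maximal function and its weak type inequality -/

theorem mul_measure_sUnion_le (h : IsTreeWith μ T C) {S : Set (Set X)} (hS : S ⊆ T)
    (g : X → ℝ≥0∞) (l : ℝ≥0∞) (hl : ∀ I ∈ S, l * μ I ≤ ∫⁻ x in I, g x ∂μ) :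
    l * μ (⋃₀ S) ≤ ∫⁻ x in ⋃₀ S, g x ∂μ := by
  obtain ⟨S', hS'S, hdisj, hU⟩ := h.exists_aedisjoint_subfamily hS
  have hc : S'.Countable := h.countable.mono (hS'S.trans hS)
  have hm : ∀ I ∈ S', NullMeasurableSet I μ := fun I hI =>
    (h.measurableSet I (hS (hS'S hI))).nullMeasurableSet
  rw [← hU, Set.sUnion_eq_biUnion, measure_biUnion₀ hc hdisj hm, lintegral_biUnion₀ hc hm hdisj,
    ← ENNReal.tsum_mul_left]
  exact ENNReal.tsum_le_tsum fun I => hl I (hS'S I.2)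

theorem setOf_lt_maximalOp (φ : X → ℝ) (l : ℝ≥0∞) :
    {x | l < maximalOp μ T φ x} = ⋃₀ {I | I ∈ T ∧ l < (∫⁻ y in I, ‖φ y‖ₑ ∂μ) / μ I} := by
  ext x
  simp only [maximalOp, Set.mem_ofPred_eq, lt_iSup_iff, Set.mem_sUnion]
  constructor
  · rintro ⟨I, hI, hx, hl⟩; exact ⟨I, ⟨hI, hl⟩, hx⟩
  · rintro ⟨I, ⟨hI, hl⟩, hx⟩; exact ⟨I, hI, hx, hl⟩

theorem measurableSet_lt_maximalOp (h : IsTreeWith μ T C) (φ : X → ℝ) (l : ℝ≥0∞) :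
    MeasurableSet {x | l < maximalOp μ T φ x} := by
  rw [setOf_lt_maximalOp]
  exact MeasurableSet.sUnion (h.countable.mono fun I hI => hI.1) fun I hI =>
    h.measurableSet I hI.1

theorem measurable_maximalOp (h : IsTreeWith μ T C) (φ : X → ℝ) :
    Measurable (maximalOp μ T φ) :=
  measurable_of_Ioi fun l => h.measurableSet_lt_maximalOp φ l

theorem mul_measure_lt_maximalOp_le (h : IsTreeWith μ T C) [IsFiniteMeasure μ] (φ : X → ℝ)
    (l : ℝ≥0∞) :
    l * μ {x | l < maximalOp μ T φ x} ≤ ∫⁻ x in {x | l < maximalOp μ T φ x}, ‖φ x‖ₑ ∂μ := by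
  rw [setOf_lt_maximalOp]
  refine h.mul_measure_sUnion_le (fun I hI => hI.1) _ l fun I hI => ?_
  rw [← ENNReal.le_div_iff_mul_le (Or.inl (h.measure_pos I hI.1).ne')
    (Or.inl (measure_ne_top μ I))]
  exact hI.2.le

/-- The weak type inequality for the maximal operator of a tree. -/
theorem mul_measure_le_maximalOp_le (h : IsTreeWith μ T C) [IsFiniteMeasure μ] {φ : X → ℝ}
    (hφ : Integrable φ μ) {l : ℝ≥0∞} (hl : l ≠ ∞) :
    l * μ {x | l ≤ maximalOp μ T φ x} ≤ ∫⁻ x in {x | l ≤ maximalOp μ T φ x}, ‖φ x‖ₑ ∂μ := by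
  rcases eq_or_ne l 0 with rfl | hl0
  · simp
  -- The supremum defining the maximal function need not be attained, so {Mφ ≥ l} is not visibly a
  -- union of tree elements. It is the decreasing intersection of the sets {Mφ > u n}, which are.
  obtain ⟨u, hu, hul, hlim⟩ := exists_seq_strictMono_tendsto' (pos_iff_ne_zero.2 hl0)
  let E : ℕ → Set X := fun n => {x | u n < maximalOp μ T φ x}
  have hE : {x | l ≤ maximalOp μ T φ x} = ⋂ n, E n := by
    ext x
    simp only [Set.mem_ofPred_eq, Set.mem_iInter, E]
    exact ⟨fun hx n => (hul n).2.trans_le hx, fun hx => le_of_tendsto' hlim fun n => (hx n).le⟩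
  have hEm : ∀ n, MeasurableSet (E n) := fun n => h.measurableSet_lt_maximalOp φ _
  have hanti : Antitone E := fun m n hmn x hx => (hu.monotone hmn).trans_lt hx
  let ρ := μ.withDensity fun x => ‖φ x‖ₑ
  have hρ : ∀ s, MeasurableSet s → ρ s = ∫⁻ x in s, ‖φ x‖ₑ ∂μ := fun s hs => withDensity_apply _ hs
  have h1 : Tendsto (ρ ∘ E) atTop (𝓝 (ρ (⋂ n, E n))) := by
    refine tendsto_measure_iInter_atTop (fun n => (hEm n).nullMeasurableSet) hanti ⟨0, ?_⟩
    rw [hρ _ (hEm 0)]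
    exact ((setLIntegral_le_lintegral _ _).trans_lt hφ.2).ne
  have h2 : Tendsto (fun n => u n * μ (⋂ n, E n)) atTop (𝓝 (l * μ (⋂ n, E n))) :=
    ENNReal.Tendsto.mul_const hlim (Or.inl hl0)
  rw [hE, ← hρ _ (MeasurableSet.iInter hEm)]
  refine le_of_tendsto_of_tendsto' h2 h1 fun n => ?_
  calc u n * μ (⋂ n, E n) ≤ u n * μ (E n) := by gcongr; exact Set.iInter_subset _ _
    _ ≤ ρ (E n) := by rw [hρ _ (hEm n)]; exact h.mul_measure_lt_maximalOp_le φ _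

/-! ### Choosing measures inside the tree and separating points -/

/-- A tree contains finite almost disjoint families whose unions have measure in any prescribed
interval. -/
theorem exists_family_measure_mem_Ioc (h : IsTreeWith μ T C) [IsProbabilityMeasure μ] {c d : ℝ≥0∞}
    (hcd : c < d) (hd : d ≤ 1) :
    ∃ S ⊆ T, S.Pairwise (AEDisjoint μ) ∧ μ (⋃₀ S) ∈ Set.Ioc c d := by
  have hε : 0 < d - c := tsub_pos_of_lt hcd
  -- On a fine enough level every set has measure below `d - c`, so adding them one at a time cannot
  -- jump over the interval.
  obtain ⟨m, hm⟩ := (h.tendsto_level.eventually_lt_const hε).exists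
  have hsmall : ∀ I ∈ treeLevel C m, μ I ≤ d - c := fun I hI =>
    (le_iSup₂ (f := fun I (_ : I ∈ treeLevel C m) => μ I) I hI).trans hm.le
  have hne : (treeLevel C m).Nonempty := by
    by_contra hcon
    have hU := h.level_sUnion m
    rw [Set.not_nonempty_iff_eq_empty.1 hcon, Set.sUnion_empty] at hU
    have := measure_univ (μ := μ)
    rw [← hU, measure_empty] at this
    exact zero_ne_one this
  obtain ⟨e, he⟩ := (h.level_countable m).exists_eq_range hne
  have hmem : ∀ i, e i ∈ treeLevel C m := fun i => he ▸ Set.mem_range_self i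
  let D : ℕ → Set X := fun n => ⋃₀ (e '' Set.Iio n)
  have hDmono : Monotone D := fun a b hab =>
    Set.sUnion_subset_sUnion (Set.image_mono (Set.Iio_subset_Iio hab))
  have hDU : ⋃ n, D n = Set.univ := by
    rw [Set.eq_univ_iff_forall]
    intro x
    obtain ⟨I, hI, hx⟩ := (h.level_sUnion m).symm ▸ Set.mem_univ x
    obtain ⟨i, rfl⟩ := he ▸ hI
    exact Set.mem_iUnion.2 ⟨i + 1, e i, ⟨i, Nat.lt_succ_self i, rfl⟩, hx⟩
  have hlim : Tendsto (μ ∘ D) atTop (𝓝 1) := by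
    have := tendsto_measure_iUnion_atTop (μ := μ) hDmono
    rwa [hDU, measure_univ] at this
  have hex : ∃ n, c < μ (D n) := (hlim.eventually_const_lt (hcd.trans_le hd)).exists
  classical
  obtain ⟨n, hn⟩ : ∃ n, Nat.find hex = n + 1 := by
    refine Nat.exists_eq_succ_of_ne_zero fun h0 => ?_
    have := Nat.find_spec hex
    rw [h0] at this
    simp [D] at this
  have hlo : μ (D n) ≤ c := not_lt.1 (Nat.find_min hex (by omega))
  have hhi : c < μ (D (n + 1)) := hn ▸ Nat.find_spec hex
  have hsub : e '' Set.Iio (n + 1) ⊆ treeLevel C m := by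
    rintro _ ⟨i, -, rfl⟩; exact hmem i
  refine ⟨e '' Set.Iio (n + 1), hsub.trans (h.level_subset m), (h.level_pairwise m).mono hsub,
    hhi, ?_⟩
  have hstep : D (n + 1) ⊆ D n ∪ e n := by
    rintro x ⟨_, ⟨i, hi, rfl⟩, hx⟩
    rcases (Nat.lt_succ_iff_lt_or_eq.1 hi) with hi | rfl
    · exact Or.inl ⟨e i, ⟨i, hi, rfl⟩, hx⟩
    · exact Or.inr hx
  calc μ (D (n + 1)) ≤ μ (D n) + μ (e n) := (measure_mono hstep).trans (measure_union_le _ _)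
    _ ≤ c + (d - c) := by gcongr; exact hsmall _ (hmem n)
    _ = d := add_tsub_cancel_of_le hcd.le

/-- The elements of a tree separate points up to null sets: some measurable real function has null
fibres. -/
theorem exists_measurable_null_fibers (h : IsTreeWith μ T C) :
    ∃ g : X → ℝ, Measurable g ∧ ∀ y, μ (g ⁻¹' {y}) = 0 := by
  obtain ⟨e, he⟩ := h.countable.exists_eq_range ⟨_, h.univ_mem⟩
  have hmem : ∀ i, e i ∈ T := fun i => he ▸ Set.mem_range_self i
  obtain ⟨j, hj⟩ := exists_measurableEmbedding_real (ℕ → Prop)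
  -- The itinerary of a point: the tree elements containing it. Points sharing an itinerary lie in a
  -- common set of every level, and the measures of these sets tend to 0.
  let b : X → ℕ → Prop := fun x n => x ∈ e n
  have hb : Measurable b :=
    measurable_pi_iff.2 fun n => measurableSet_setOfPred.1 (h.measurableSet _ (hmem n))
  refine ⟨j ∘ b, hj.measurable.comp hb, fun y => ?_⟩
  rcases Set.eq_empty_or_nonempty ((j ∘ b) ⁻¹' {y}) with he' | ⟨x, hx⟩
  · rw [he', measure_empty]
  refine le_antisymm (ge_of_tendsto' h.tendsto_level fun m => ?_) zero_le
  obtain ⟨I, hI, hxI⟩ := (h.level_sUnion m).symm ▸ Set.mem_univ x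
  refine le_trans (measure_mono fun z hz => ?_)
    (le_iSup₂ (f := fun I (_ : I ∈ treeLevel C m) => μ I) I hI)
  obtain ⟨n, rfl⟩ := he ▸ h.level_subset m hI
  have hbz : b z = b x := hj.injective (hz.trans hx.symm)
  have : b z n = b x n := congrFun hbz n
  exact this.mpr hxI

end IsTreeWith

/-! ### Uniformly distributed functions -/

open ProbabilityTheory in
/-- The distribution function of an atomless probability measure is uniformly distributed. -/
theorem map_cdf_eq_restrict_Ioc (ν : Measure ℝ) [IsProbabilityMeasure ν]
    (hν : ∀ y, ν {y} = 0) : ν.map (cdf ν) = volume.restrict (Set.Ioc 0 1) := by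
  have hmeas : Measurable (cdf ν) := (monotone_cdf ν).measurable
  have hcont : Continuous (cdf ν) := by
    rw [continuous_iff_continuousAt]
    intro x
    have h := (cdf ν).measure_singleton x
    rw [measure_cdf, hν, eq_comm, ENNReal.ofReal_eq_zero, sub_nonpos] at h
    rw [(monotone_cdf ν).continuousAt_iff_leftLim_eq_rightLim, (cdf ν).rightLim_eq]
    exact le_antisymm ((monotone_cdf ν).leftLim_le le_rfl) h
  have hex : ∀ t ∈ Set.Ioo (0 : ℝ) 1, ∃ x, cdf ν x = t := by
    intro t ht
    have h0 := ((tendsto_cdf_atBot ν).eventually_lt_const ht.1).exists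
    have h1 := ((tendsto_cdf_atTop ν).eventually_const_lt ht.2).exists
    obtain ⟨a, ha⟩ := h0
    obtain ⟨b, hb⟩ := h1
    exact mem_range_of_exists_le_of_exists_ge hcont ⟨a, ha.le⟩ ⟨b, hb.le⟩
  have hlow : ∀ t ∈ Set.Ioo (0 : ℝ) 1, ENNReal.ofReal t ≤ ν (cdf ν ⁻¹' Set.Iic t) := by
    intro t ht
    obtain ⟨x, hx⟩ := hex t ht
    rw [← hx, ofReal_cdf]
    exact measure_mono fun y hy => monotone_cdf ν hy
  -- The distribution function may be constant on an interval where it equals `t`, so the upper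
  -- bound is taken at levels `s > t`, followed by `s ↓ t`.
  have hup : ∀ t ∈ Set.Ioo (0 : ℝ) 1, ν (cdf ν ⁻¹' Set.Iic t) ≤ ENNReal.ofReal t := by
    intro t ht
    have hlim : Tendsto ENNReal.ofReal (𝓝[>] t) (𝓝 (ENNReal.ofReal t)) :=
      (ENNReal.continuous_ofReal.tendsto t).mono_left nhdsWithin_le_nhds
    refine ge_of_tendsto hlim ?_
    filter_upwards [Ioo_mem_nhdsGT ht.2] with s hs
    obtain ⟨x, hx⟩ := hex s ⟨ht.1.trans hs.1, hs.2⟩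
    rw [← hx, ofReal_cdf]
    refine measure_mono fun y hy => ?_
    by_contra hxy
    exact absurd (monotone_cdf ν (not_le.1 hxy).le) (not_le.2 (hx ▸ lt_of_le_of_lt hy hs.1))
  have : IsProbabilityMeasure (ν.map (cdf ν)) := Measure.isProbabilityMeasure_map hmeas.aemeasurable
  refine Measure.ext_of_Iic _ _ fun t => ?_
  rw [Measure.map_apply hmeas measurableSet_Iic, Measure.restrict_apply measurableSet_Iic]
  rcases lt_or_ge t 1 with ht1 | ht1
  · rcases lt_or_ge 0 t with ht0 | ht0
    · rw [le_antisymm (hup t ⟨ht0, ht1⟩) (hlow t ⟨ht0, ht1⟩), Set.inter_comm, Set.Ioc_inter_Iic,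
        Real.volume_Ioc, min_eq_right ht1.le, sub_zero]
    · rw [Set.inter_comm, Set.Ioc_inter_Iic, Real.volume_Ioc, min_eq_right ht1.le, sub_zero,
        ENNReal.ofReal_of_nonpos ht0, ← nonpos_iff_eq_zero]
      have hlim : Tendsto ENNReal.ofReal (𝓝[>] 0) (𝓝 0) := by
        have := (ENNReal.continuous_ofReal.tendsto (0 : ℝ)).mono_left
          (nhdsWithin_le_nhds (s := Set.Ioi 0))
        rwa [ENNReal.ofReal_zero] at this
      refine ge_of_tendsto hlim ?_
      filter_upwards [Ioo_mem_nhdsGT (zero_lt_one (α := ℝ))] with s hs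
      have hsub : cdf ν ⁻¹' Set.Iic t ⊆ cdf ν ⁻¹' Set.Iic s :=
        Set.preimage_mono (Set.Iic_subset_Iic.2 (ht0.trans hs.1.le))
      exact (measure_mono hsub).trans (hup s hs)
  · have : cdf ν ⁻¹' Set.Iic t = Set.univ :=
      Set.eq_univ_of_forall fun y => (cdf_le_one ν y).trans ht1
    rw [this, measure_univ, Set.inter_comm, Set.Ioc_inter_Iic, min_eq_left ht1]
    simp

theorem map_affine_restrict_Ioc (a : ℝ) {c : ℝ} (hc : 0 < c) :
    (volume.restrict (Set.Ioc (0 : ℝ) 1)).map (fun x => a + c * x) =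
      (ENNReal.ofReal c)⁻¹ • volume.restrict (Set.Ioc a (a + c)) := by
  have hpre : (fun x => a + c * x) ⁻¹' Set.Ioc a (a + c) = Set.Ioc 0 1 := by
    ext x
    simp only [Set.mem_preimage, Set.mem_Ioc, lt_add_iff_pos_right, add_le_add_iff_left]
    rw [mul_pos_iff_of_pos_left hc, mul_le_iff_le_one_right hc]
  rw [← hpre, ← Measure.restrict_map (by fun_prop) measurableSet_Ioc]
  have : (fun x => a + c * x) = (fun x => a + x) ∘ (fun x => c * x) := rfl
  rw [this, ← Measure.map_map (by fun_prop) (by fun_prop), Real.map_volume_mul_left hc.ne',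
    Measure.map_smul, map_add_left_eq_self, Measure.restrict_smul, abs_of_pos (inv_pos.2 hc),
    ENNReal.ofReal_inv_of_pos hc]

/-- If some measurable real function has null fibres, then on every set there is a function that is
uniformly distributed on a given interval. -/
theorem exists_map_restrict_eq_uniform {μ : Measure X} [IsFiniteMeasure μ] {g : X → ℝ}
    (hg : Measurable g) (hg0 : ∀ y, μ (g ⁻¹' {y}) = 0) (s : Set X) (a : ℝ) {c : ℝ} (hc : 0 < c) :
    ∃ V : X → ℝ, Measurable V ∧
      (μ.restrict s).map V = (μ s / ENNReal.ofReal c) • volume.restrict (Set.Ioc a (a + c)) := by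
  rcases eq_or_ne (μ s) 0 with hs0 | hs0
  · refine ⟨fun _ => 0, measurable_const, ?_⟩
    rw [Measure.restrict_eq_zero.2 hs0, Measure.map_zero, hs0, ENNReal.zero_div, zero_smul]
  let ν : Measure ℝ := (μ s)⁻¹ • (μ.restrict s).map g
  have hprob : IsProbabilityMeasure ν := by
    constructor
    simp only [ν, Measure.smul_apply, smul_eq_mul]
    rw [Measure.map_apply hg MeasurableSet.univ, Set.preimage_univ, Measure.restrict_apply_univ,
      ENNReal.inv_mul_cancel hs0 (measure_ne_top μ s)]
  have hν : ∀ y, ν {y} = 0 := by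
    intro y
    simp only [ν, Measure.smul_apply, smul_eq_mul]
    rw [Measure.map_apply hg (measurableSet_singleton y)]
    have : μ.restrict s (g ⁻¹' {y}) = 0 :=
      le_antisymm ((Measure.restrict_apply_le _ _).trans_eq (hg0 y)) zero_le
    rw [this, mul_zero]
  have hF : Measurable (ProbabilityTheory.cdf ν) := (ProbabilityTheory.monotone_cdf ν).measurable
  have hmap : (μ.restrict s).map g = μ s • ν := by
    rw [smul_smul, ENNReal.mul_inv_cancel hs0 (measure_ne_top μ s), one_smul]
  refine ⟨(fun x => a + c * x) ∘ ProbabilityTheory.cdf ν ∘ g,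
    (by fun_prop : Measurable fun x : ℝ => a + c * x).comp (hF.comp hg), ?_⟩
  rw [← Measure.map_map (by fun_prop) (hF.comp hg), ← Measure.map_map hF hg, hmap,
    Measure.map_smul, Measure.map_smul, map_cdf_eq_restrict_Ioc ν hν, map_affine_restrict_Ioc a hc,
    smul_smul, ENNReal.div_eq_inv_mul, mul_comm]

/-- A uniformly distributed function on `X` which is also uniformly distributed, on `(0, k]`, on
each member of a given almost disjoint family of total measure `k`. -/
theorem exists_uniform_on_family {μ : Measure X} [IsProbabilityMeasure μ] {g : X → ℝ}
    (hg : Measurable g) (hg0 : ∀ y, μ (g ⁻¹' {y}) = 0) {S : Set (Set X)} (hS : S.Countable)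
    (hSm : ∀ I ∈ S, MeasurableSet I) (hSd : S.Pairwise (AEDisjoint μ)) {k : ℝ} (hk : 0 < k)
    (hSk : μ (⋃₀ S) = ENNReal.ofReal k) :
    ∃ U : X → ℝ, Measurable U ∧ μ.map U = volume.restrict (Set.Ioc 0 1) ∧
      ∀ I ∈ S, (μ.restrict I).map U =
        (μ I / ENNReal.ofReal k) • volume.restrict (Set.Ioc 0 k) := by
  have hk1 : k ≤ 1 := by
    have := prob_le_one (μ := μ) (s := ⋃₀ S)
    rwa [hSk, ENNReal.ofReal_le_one] at this
  have := hS.to_subtype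
  have hSd' : Pairwise (Function.onFun (AEDisjoint μ) fun I : S => (I : Set X)) := fun I J hIJ =>
    hSd I.2 J.2 (Subtype.coe_injective.ne hIJ)
  -- Discarding null sets makes the members genuinely disjoint, so that functions can be glued.
  obtain ⟨t, htm, ht0, htd⟩ := exists_null_pairwise_disjoint_sdiff hSd'
  have hEm : MeasurableSet (⋃₀ S) := MeasurableSet.sUnion hS hSm
  have hcompl : μ (⋃₀ S)ᶜ = ENNReal.ofReal (1 - k) := by
    rw [prob_compl_eq_one_sub hEm, hSk, ENNReal.ofReal_sub _ hk.le, ENNReal.ofReal_one]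
  choose V hVm hV using fun I : S => exists_map_restrict_eq_uniform hg hg0 (I : Set X) 0 hk
  -- Off the family the values fill the remaining interval `(k, 1]`; for `k = 1` the complement is
  -- null and any function serves.
  obtain ⟨V₀, hV₀m, hV₀⟩ : ∃ V : X → ℝ, Measurable V ∧
      (μ.restrict (⋃₀ S)ᶜ).map V = volume.restrict (Set.Ioc k 1) := by
    rcases hk1.eq_or_lt with rfl | hk1
    · refine ⟨fun _ => 0, measurable_const, ?_⟩
      rw [sub_self, ENNReal.ofReal_zero] at hcompl
      rw [Measure.restrict_eq_zero.2 hcompl, Measure.map_zero, Set.Ioc_self,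
        Measure.restrict_empty]
    · obtain ⟨V, hVm, hV⟩ := exists_map_restrict_eq_uniform hg hg0 (⋃₀ S)ᶜ k (sub_pos.2 hk1)
      refine ⟨V, hVm, ?_⟩
      rw [hV, hcompl, ENNReal.div_self (by simpa using hk1) ENNReal.ofReal_ne_top, one_smul,
        add_sub_cancel]
  obtain ⟨U, hUm, hU⟩ := exists_measurable_piecewise
    (fun i : Option S => i.elim (⋃₀ S)ᶜ fun I => (I : Set X) \ t I)
    (by rintro (_ | I)
        · exact hEm.compl
        · exact (hSm I I.2).diff (htm I))
    (fun i : Option S => i.elim V₀ V)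
    (by rintro (_ | I)
        · exact hV₀m
        · exact hVm I)
    (by rintro (_ | I) (_ | J) hne x hx
        · exact absurd rfl hne
        · exact absurd (Set.mem_sUnion_of_mem hx.2.1 J.2) hx.1
        · exact absurd (Set.mem_sUnion_of_mem hx.1.1 I.2) hx.2
        · exact absurd hx.2 (Set.disjoint_left.1 (htd fun e => hne (congrArg some e)) hx.1))
  have hUI : ∀ I ∈ S, (μ.restrict I).map U =
      (μ I / ENNReal.ofReal k) • volume.restrict (Set.Ioc 0 k) := by
    intro I hI
    have hae : U =ᵐ[μ.restrict I] V ⟨I, hI⟩ := by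
      refine (ae_restrict_iff' (hSm I hI)).2 ?_
      filter_upwards [measure_eq_zero_iff_ae_notMem.1 (ht0 ⟨I, hI⟩)] with x hx hxI
      exact hU (some ⟨I, hI⟩) ⟨hxI, hx⟩
    rw [Measure.map_congr hae, hV, zero_add]
  have hU₀ : (μ.restrict (⋃₀ S)ᶜ).map U = volume.restrict (Set.Ioc k 1) := by
    rw [← hV₀]
    refine Measure.map_congr ((ae_restrict_iff' hEm.compl).2 (Eventually.of_forall fun x hx => ?_))
    exact hU none hx
  have hUE : (μ.restrict (⋃₀ S)).map U = volume.restrict (Set.Ioc 0 k) := by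
    ext B hB
    rw [Measure.map_apply hUm hB, Set.sUnion_eq_iUnion,
      Measure.restrict_iUnion_apply_ae hSd' (fun I => (hSm I I.2).nullMeasurableSet) (hUm hB)]
    have : ∀ I : S, μ.restrict I (U ⁻¹' B) =
        μ I * ((ENNReal.ofReal k)⁻¹ * volume.restrict (Set.Ioc 0 k) B) := fun I => by
      rw [← Measure.map_apply hUm hB, hUI I I.2, Measure.smul_apply, smul_eq_mul,
        ENNReal.div_eq_inv_mul]
      ring
    have hsum : ∑' I : S, μ I = ENNReal.ofReal k := by
      rw [← hSk, Set.sUnion_eq_iUnion, measure_iUnion₀ hSd' fun I => (hSm I I.2).nullMeasurableSet]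
    simp_rw [this]
    rw [ENNReal.tsum_mul_right, hsum, ← mul_assoc, ENNReal.mul_inv_cancel (by simpa using hk)
      ENNReal.ofReal_ne_top, one_mul]
  refine ⟨U, hUm, ?_, hUI⟩
  rw [← Measure.restrict_add_restrict_compl (μ := μ) hEm, Measure.map_add _ _ hUm, hUE, hU₀,
    ← Measure.restrict_union (Set.Ioc_disjoint_Ioc_of_le le_rfl) measurableSet_Ioc,
    Set.Ioc_union_Ioc_eq_Ioc hk.le hk1]

/-! ### The norm constraint and interpolation of moments -/

theorem setLIntegral_enorm_eq_ofReal {μ : Measure X} {φ : X → ℝ} (hφ : Integrable φ μ)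
    (h0 : ∀ x, 0 ≤ φ x) (E : Set X) :
    ∫⁻ x in E, ‖φ x‖ₑ ∂μ = ENNReal.ofReal (∫ x in E, φ x ∂μ) := by
  rw [ofReal_integral_eq_lintegral_ofReal hφ.restrict (Eventually.of_forall h0)]
  exact lintegral_congr fun x => Real.enorm_of_nonneg (h0 x)

theorem weakNorm_le_one_iff {μ : Measure X} [IsFiniteMeasure μ] {p : ℝ} (hp : 1 < p) {φ : X → ℝ}
    (hφ : Integrable φ μ) (h0 : ∀ x, 0 ≤ φ x) :
    weakNorm μ p φ ≤ 1 ↔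
      ∀ E, MeasurableSet E → ∫ x in E, φ x ∂μ ≤ μ.real E ^ (1 - 1 / p) := by
  have hp' : 0 < 1 - 1 / p := by
    rw [sub_pos, div_lt_one (by linarith)]; exact hp
  simp only [weakNorm, iSup_le_iff]
  refine forall₂_congr fun E hE => ?_
  rw [setLIntegral_enorm_eq_ofReal hφ h0]
  rcases eq_or_ne (μ E) 0 with hE0 | hE0
  · simp [hE0, setIntegral_measure_zero, Real.rpow_nonneg]
  have hpos : 0 < μ.real E := ENNReal.toReal_pos hE0 (measure_ne_top μ E)
  rw [imp_iff_right (pos_iff_ne_zero.2 hE0), ← ofReal_measureReal (μ := μ) (s := E),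
    ENNReal.ofReal_rpow_of_pos hpos, ← ENNReal.ofReal_mul (by positivity), ENNReal.ofReal_le_one,
    show (-1 + 1 / p : ℝ) = -(1 - 1 / p) by ring, Real.rpow_neg hpos.le,
    inv_mul_le_iff₀ (by positivity), mul_one]

/-- Interpolation between two functions with the same integral. -/
theorem HasMoments.exists_between {μ : Measure X} {q f A A₀ A₁ : ℝ} (hq : 1 < q) {φ₀ φ₁ : X → ℝ}
    (h₀ : HasMoments μ q f A₀ φ₀) (h₁ : HasMoments μ q f A₁ φ₁) (hA₀ : A₀ ≤ A) (hA₁ : A ≤ A₁) :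
    ∃ s ∈ Set.Icc (0 : ℝ) 1, HasMoments μ q f A fun x => (1 - s) * φ₀ x + s * φ₁ x := by
  have hq0 : 0 < q := by linarith
  have hm₀ := h₀.measurable
  have hm₁ := h₁.measurable
  have hqe0 : ENNReal.ofReal q ≠ 0 := by simpa using hq0
  have memLp : ∀ {B : ℝ} {φ : X → ℝ}, HasMoments μ q f B φ → MemLp φ (ENNReal.ofReal q) μ := by
    intro B φ h
    rw [← integrable_norm_rpow_iff h.measurable.aestronglyMeasurable hqe0 ENNReal.ofReal_ne_top,
      ENNReal.toReal_ofReal hq0.le]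
    simpa only [Real.norm_of_nonneg (h.nonneg _)] using h.integrable_rpow
  have hbound : Integrable (fun x => (φ₀ x + φ₁ x) ^ q) μ := by
    have := ((memLp h₀).add (memLp h₁)).integrable_norm_rpow hqe0 ENNReal.ofReal_ne_top
    rw [ENNReal.toReal_ofReal hq0.le] at this
    simpa only [Pi.add_apply, Real.norm_of_nonneg (add_nonneg (h₀.nonneg _) (h₁.nonneg _))]
      using this
  have hnn : ∀ s ∈ Set.Icc (0 : ℝ) 1, ∀ x, 0 ≤ (1 - s) * φ₀ x + s * φ₁ x := fun s hs x =>
    add_nonneg (mul_nonneg (sub_nonneg.2 hs.2) (h₀.nonneg x)) (mul_nonneg hs.1 (h₁.nonneg x))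
  have hle : ∀ s ∈ Set.Icc (0 : ℝ) 1, ∀ x,
      ‖((1 - s) * φ₀ x + s * φ₁ x) ^ q‖ ≤ (φ₀ x + φ₁ x) ^ q := by
    intro s hs x
    rw [Real.norm_of_nonneg (Real.rpow_nonneg (hnn s hs x) q)]
    refine Real.rpow_le_rpow (hnn s hs x) ?_ hq0.le
    have a := h₀.nonneg x
    have b := h₁.nonneg x
    nlinarith [mul_nonneg hs.1 a, mul_nonneg (sub_nonneg.2 hs.2) b]
  -- Dominated convergence with the bound `(φ₀ + φ₁) ^ q`; the intermediate value theorem then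
  -- supplies `s`.
  have hcont : ContinuousOn (fun s : ℝ => ∫ x, ((1 - s) * φ₀ x + s * φ₁ x) ^ q ∂μ)
      (Set.Icc 0 1) := by
    refine continuousOn_of_dominated (bound := fun x => (φ₀ x + φ₁ x) ^ q) (fun s _ => ?_)
      (fun s hs => Eventually.of_forall (hle s hs)) hbound (Eventually.of_forall fun x => ?_)
    · exact (by fun_prop : Measurable fun x => ((1 - s) * φ₀ x + s * φ₁ x) ^ q).aestronglyMeasurable
    · exact ContinuousOn.rpow_const (by fun_prop) fun s _ => Or.inr hq0.le
  obtain ⟨s, hs, hsA⟩ := intermediate_value_Icc zero_le_one hcont (show A ∈ Set.Icc _ _ by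
    simp only [sub_zero, one_mul, zero_mul, add_zero, sub_self, zero_add, h₀.integral_rpow_eq,
      h₁.integral_rpow_eq]
    exact ⟨hA₀, hA₁⟩)
  refine ⟨s, hs, by fun_prop, hnn s hs,
    (h₀.integrable.const_mul _).add (h₁.integrable.const_mul _), ?_, ?_, hsA⟩
  · rw [integral_add (h₀.integrable.const_mul _) (h₁.integrable.const_mul _),
      integral_const_mul, integral_const_mul, h₀.integral_eq, h₁.integral_eq]
    ring
  · exact hbound.mono'
      (by fun_prop : Measurable fun x => ((1 - s) * φ₀ x + s * φ₁ x) ^ q).aestronglyMeasurable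
      (Eventually.of_forall (hle s hs))

/-! ### The truncated power as extremal function -/

/-- The truncated extremal function `(1 - 1/p) t^(-1/p)` on `(0, a]`. -/
noncomputable def truncatedPower (p a : ℝ) : ℝ → ℝ :=
  (Set.Ioc 0 a).indicator fun t => (1 - 1 / p) * t ^ (-(1 / p))

theorem one_div_mem_Ioo {p : ℝ} (hp : 1 < p) : 1 / p ∈ Set.Ioo (0 : ℝ) 1 :=
  ⟨by positivity, by rw [div_lt_one (by linarith)]; exact hp⟩

theorem measurable_truncatedPower (p a : ℝ) : Measurable (truncatedPower p a) :=
  (by fun_prop : Measurable fun t : ℝ => (1 - 1 / p) * t ^ (-(1 / p))).indicator measurableSet_Ioc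

theorem truncatedPower_nonneg {p : ℝ} (hp : 1 < p) (a t : ℝ) : 0 ≤ truncatedPower p a t :=
  Set.indicator_nonneg (fun _ ht => mul_nonneg (sub_nonneg.2 (one_div_mem_Ioo hp).2.le)
    (Real.rpow_nonneg ht.1.le _)) t

theorem integrableOn_rpow_Ioc {r : ℝ} (hr : -1 < r) {b : ℝ} (hb : 0 ≤ b) :
    IntegrableOn (fun t : ℝ => t ^ r) (Set.Ioc 0 b) := by
  rw [← intervalIntegrable_iff_integrableOn_Ioc_of_le hb]
  exact intervalIntegral.intervalIntegrable_rpow' hr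

theorem setIntegral_rpow_Ioc {r : ℝ} (hr : -1 < r) {b : ℝ} (hb : 0 ≤ b) :
    ∫ t in Set.Ioc 0 b, t ^ r = b ^ (r + 1) / (r + 1) := by
  rw [← intervalIntegral.integral_of_le hb, integral_rpow (Or.inl hr),
    Real.zero_rpow (by linarith), sub_zero]

theorem setIntegral_truncatedPower {p : ℝ} (hp : 1 < p) {a b : ℝ} (ha : 0 ≤ a) (hb : 0 ≤ b) :
    ∫ t in Set.Ioc 0 b, truncatedPower p a t = (min b a) ^ (1 - 1 / p) := by
  have h := one_div_mem_Ioo hp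
  rw [truncatedPower, setIntegral_indicator measurableSet_Ioc, Set.Ioc_inter_Ioc, max_self,
    integral_const_mul, setIntegral_rpow_Ioc (by linarith [h.2]) (le_min hb ha),
    show -(1 / p) + 1 = 1 - 1 / p by ring, mul_div_cancel₀ _ (by linarith [h.2])]

theorem integrable_truncatedPower {p : ℝ} (hp : 1 < p) {a : ℝ} (ha : 0 ≤ a) :
    Integrable (truncatedPower p a) := by
  have h := one_div_mem_Ioo hp
  exact (integrable_indicator_iff measurableSet_Ioc).2
    ((integrableOn_rpow_Ioc (by linarith [h.2]) ha).const_mul _)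

theorem truncatedPower_rpow {p : ℝ} (hp : 1 < p) {q : ℝ} (hq : 0 < q) (a : ℝ) :
    (fun t => truncatedPower p a t ^ q) =
      (Set.Ioc 0 a).indicator fun t => (1 - 1 / p) ^ q * t ^ (-(q / p)) := by
  have h := one_div_mem_Ioo hp
  funext t
  by_cases ht : t ∈ Set.Ioc 0 a
  · rw [truncatedPower, Set.indicator_of_mem ht, Set.indicator_of_mem ht,
      Real.mul_rpow (by linarith [h.2]) (Real.rpow_nonneg ht.1.le _), ← Real.rpow_mul ht.1.le]
    congr 2
    ring
  · rw [truncatedPower, Set.indicator_of_notMem ht, Set.indicator_of_notMem ht,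
      Real.zero_rpow hq.ne']

/-- The profile decreases on its support, so only on `(0, b]` can it exceed the value at `b` of the
untruncated power. This pointwise form of the bathtub principle bounds integrals over any set of
measure `b` without rearrangements. -/
theorem truncatedPower_le_add {p : ℝ} (hp : 1 < p) (a : ℝ) {b : ℝ} (hb : 0 < b) (t : ℝ) :
    truncatedPower p a t ≤ (1 - 1 / p) * b ^ (-(1 / p)) +
      (Set.Ioc 0 b).indicator
        (fun t => (1 - 1 / p) * t ^ (-(1 / p)) - (1 - 1 / p) * b ^ (-(1 / p))) t := by
  have h := one_div_mem_Ioo hp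
  have h1 : 0 ≤ 1 - 1 / p := by linarith [h.2]
  have hH : 0 ≤ (1 - 1 / p) * b ^ (-(1 / p)) := mul_nonneg h1 (Real.rpow_nonneg hb.le _)
  by_cases ht0 : 0 < t
  · have hle : truncatedPower p a t ≤ (1 - 1 / p) * t ^ (-(1 / p)) :=
      Set.indicator_apply_le' (fun _ => le_rfl)
        fun _ => mul_nonneg h1 (Real.rpow_nonneg ht0.le _)
    refine hle.trans ?_
    by_cases htb : t ≤ b
    · rw [Set.indicator_of_mem (show t ∈ Set.Ioc 0 b from ⟨ht0, htb⟩)]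
      linarith
    · rw [Set.indicator_of_notMem fun ht : t ∈ Set.Ioc 0 b => htb ht.2, add_zero]
      exact mul_le_mul_of_nonneg_left (Real.rpow_le_rpow_of_nonpos hb (not_le.1 htb).le
        (by linarith [h.1])) h1
  · rw [truncatedPower, Set.indicator_of_notMem fun ht : t ∈ Set.Ioc 0 a => ht0 ht.1,
      Set.indicator_of_notMem fun ht : t ∈ Set.Ioc 0 b => ht0 ht.1, add_zero]
    exact hH

/-- The composition of the extremal function with a uniformly distributed function satisfies the
weak type bound. -/
theorem setIntegral_truncatedPower_comp_le {μ : Measure X} [IsProbabilityMeasure μ] {U : X → ℝ}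
    (hU : Measurable U) (hUμ : μ.map U = volume.restrict (Set.Ioc 0 1)) {p : ℝ} (hp : 1 < p)
    {a : ℝ} (ha : 0 ≤ a) (E : Set X) :
    ∫ x in E, truncatedPower p a (U x) ∂μ ≤ μ.real E ^ (1 - 1 / p) := by
  have h := one_div_mem_Ioo hp
  have h1 : 0 ≤ 1 - 1 / p := by linarith [h.2]
  obtain ⟨b, hb⟩ : ∃ b, μ.real E = b := ⟨_, rfl⟩
  have hb1 : b ≤ 1 := hb ▸ measureReal_le_one
  rw [hb]
  rcases (hb ▸ measureReal_nonneg : 0 ≤ b).eq_or_lt with hb0 | hb0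
  · rw [← hb0, setIntegral_measure_zero]
    · positivity
    · exact (measureReal_eq_zero_iff (by finiteness)).1 (hb.trans hb0.symm)
  set y := (1 - 1 / p) * b ^ (-(1 / p))
  let K : ℝ → ℝ := (Set.Ioc 0 b).indicator fun t => (1 - 1 / p) * t ^ (-(1 / p)) - y
  have hK0 : ∀ t, 0 ≤ K t := fun t => Set.indicator_nonneg (fun t ht => sub_nonneg.2
    (mul_le_mul_of_nonneg_left (Real.rpow_le_rpow_of_nonpos ht.1 ht.2 (by linarith [h.1])) h1)) t
  have hpow : IntegrableOn (fun t : ℝ => (1 - 1 / p) * t ^ (-(1 / p))) (Set.Ioc 0 b) :=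
    (integrableOn_rpow_Ioc (by linarith [h.2]) hb0.le).const_mul _
  have hKon : IntegrableOn (fun t : ℝ => (1 - 1 / p) * t ^ (-(1 / p)) - y) (Set.Ioc 0 b) :=
    hpow.sub (integrableOn_const (by simp))
  have hKi : Integrable K := (integrable_indicator_iff measurableSet_Ioc).2 hKon
  have hKU : Integrable (fun x => K (U x)) μ := by
    have : Integrable K (μ.map U) := hUμ ▸ hKi.restrict
    exact this.comp_measurable hU
  have hψU : Integrable (fun x => truncatedPower p a (U x)) μ := by
    have : Integrable (truncatedPower p a) (μ.map U) :=
      hUμ ▸ (integrable_truncatedPower hp ha).restrict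
    exact this.comp_measurable hU
  have hKint : ∫ x, K (U x) ∂μ = b ^ (1 - 1 / p) - y * b := by
    have h2 : ∫ t in Set.Ioc 0 b, (1 - 1 / p) * t ^ (-(1 / p)) = b ^ (1 - 1 / p) := by
      rw [integral_const_mul, setIntegral_rpow_Ioc (by linarith [h.2]) hb0.le,
        show -(1 / p) + 1 = 1 - 1 / p by ring, mul_div_cancel₀ _ (by linarith [h.2])]
    rw [← integral_map hU.aemeasurable (hUμ ▸ hKi.restrict.aestronglyMeasurable), hUμ,
      setIntegral_indicator measurableSet_Ioc, Set.Ioc_inter_Ioc, max_self, min_eq_right hb1,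
      integral_sub hpow (integrableOn_const (by simp)), h2]
    simp [hb0.le, mul_comm y]
  calc ∫ x in E, truncatedPower p a (U x) ∂μ
      ≤ ∫ x in E, (y + K (U x)) ∂μ := by
        refine integral_mono hψU.restrict ((integrable_const _).add hKU.restrict) fun x => ?_
        exact truncatedPower_le_add hp a hb0 (U x)
    _ = y * b + ∫ x in E, K (U x) ∂μ := by
        rw [integral_add (integrable_const _) hKU.restrict]
        simp [hb, mul_comm y]
    -- The excess `K` is nonnegative, so its integral over `E` is largest when `E` is everything.
    _ ≤ y * b + ∫ x, K (U x) ∂μ := by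
        exact add_le_add_right
          (setIntegral_le_integral hKU (Eventually.of_forall fun x => hK0 _)) _
    _ = b ^ (1 - 1 / p) := by rw [hKint]; ring

theorem hasMoments_truncatedPower_comp {μ : Measure X} [IsProbabilityMeasure μ] {U : X → ℝ}
    (hU : Measurable U) (hUμ : μ.map U = volume.restrict (Set.Ioc 0 1)) {p q : ℝ} (hq : 1 < q)
    (hqp : q < p) {f : ℝ} (hf : 0 < f) (hf1 : f ≤ 1) :
    HasMoments μ q f (gammaConst p q * f ^ ((p - q) / (p - 1)))
      (fun x => truncatedPower p (f ^ (p / (p - 1))) (U x)) := by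
  have hp : 1 < p := hq.trans hqp
  have hp0 : 0 < p := by linarith
  have hq0 : 0 < q := by linarith
  have hp1 : 0 < p - 1 := by linarith
  have h := one_div_mem_Ioo hp
  -- The truncation point solves `a ^ (1 - 1 / p) = f`, which makes the mean equal to `f`.
  set a := f ^ (p / (p - 1)) with ha
  have ha0 : 0 ≤ a := by positivity
  have ha1 : a ≤ 1 := Real.rpow_le_one hf.le hf1 (by positivity)
  have hqp' : q / p < 1 := by rwa [div_lt_one hp0]
  have hm := measurable_truncatedPower p a
  have hi := integrable_truncatedPower hp ha0
  have hiq : Integrable fun t => truncatedPower p a t ^ q := by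
    rw [truncatedPower_rpow hp hq0]
    exact (integrable_indicator_iff measurableSet_Ioc).2
      ((integrableOn_rpow_Ioc (by linarith) ha0).const_mul _)
  have hmq : Measurable fun t => truncatedPower p a t ^ q := by fun_prop
  refine ⟨hm.comp hU, fun x => truncatedPower_nonneg hp a _, ?_, ?_, ?_, ?_⟩
  · exact (hUμ ▸ hi.restrict : Integrable (truncatedPower p a) (μ.map U)).comp_measurable hU
  · rw [← integral_map hU.aemeasurable hm.aestronglyMeasurable, hUμ,
      setIntegral_truncatedPower hp ha0 zero_le_one, min_eq_right ha1, ha, ← Real.rpow_mul hf.le,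
      show p / (p - 1) * (1 - 1 / p) = 1 by field_simp, Real.rpow_one]
  · exact (hUμ ▸ hiq.restrict :
      Integrable (fun t => truncatedPower p a t ^ q) (μ.map U)).comp_measurable hU
  · rw [← integral_map (f := fun t => truncatedPower p a t ^ q) hU.aemeasurable
      hmq.aestronglyMeasurable, hUμ, truncatedPower_rpow hp hq0,
      setIntegral_indicator measurableSet_Ioc, Set.Ioc_inter_Ioc, max_self, min_eq_right ha1,
      integral_const_mul, setIntegral_rpow_Ioc (by linarith) ha0, ha, ← Real.rpow_mul hf.le,
      gammaConst, show p / (p - 1) * (-(q / p) + 1) = (p - q) / (p - 1) by field_simp; ring,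
      show 1 - 1 / p = (p - 1) / p by field_simp]
    have : -(q / p) + 1 = (p - q) / p := by field_simp; ring
    rw [this, div_div_eq_mul_div, mul_div_assoc]
    ring

/-- Uniformity of `U` on `(0, k]` gives every member of positive measure the same average, that of
the profile over `(0, k]`. -/
theorem setIntegral_truncatedPower_comp {μ : Measure X} {U : X → ℝ}
    (hU : Measurable U) {p : ℝ} (hp : 1 < p) {a k : ℝ} (ha : 0 ≤ a) (hk : 0 < k) {I : Set X}
    (hI : (μ.restrict I).map U = (μ I / ENNReal.ofReal k) • volume.restrict (Set.Ioc 0 k)) :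
    ∫ x in I, truncatedPower p a (U x) ∂μ = μ.real I / k * (min k a) ^ (1 - 1 / p) := by
  rw [← integral_map hU.aemeasurable (measurable_truncatedPower p a).aestronglyMeasurable, hI,
    integral_smul_measure, setIntegral_truncatedPower hp ha hk.le, ENNReal.toReal_div,
    ENNReal.toReal_ofReal hk.le, smul_eq_mul, measureReal_def]

/-! ### Two-valued functions: norm bound and minimal moment -/

theorem rpow_add_mul_sub_le_rpow {a b q : ℝ} (ha : 0 ≤ a) (hb : 0 ≤ b) (hq : 1 < q) :
    a ^ q + q * a ^ (q - 1) * (b - a) ≤ b ^ q := by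
  rcases ha.eq_or_lt with rfl | ha
  · rw [Real.zero_rpow (by linarith), Real.zero_rpow (by linarith)]
    simpa using Real.rpow_nonneg hb q
  have h := one_add_mul_self_le_rpow_one_add (s := b / a - 1)
    (by linarith [div_nonneg hb ha.le]) hq.le
  rw [add_sub_cancel, Real.div_rpow hb ha.le, le_div_iff₀ (by positivity)] at h
  have hpow : a ^ q = a ^ (q - 1) * a := by
    rw [← Real.rpow_add_one ha.ne', sub_add_cancel]
  refine le_of_eq_of_le ?_ h
  rw [hpow]
  field_simp

theorem le_rpow_neg_one_div_iff {e l p : ℝ} (he : 0 < e) (hl : 0 < l) (hp : 0 < p) :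
    l ≤ e ^ (-(1 / p)) ↔ e ≤ 1 / l ^ p := by
  rw [← Real.rpow_le_rpow_iff hl.le (by positivity) hp, ← Real.rpow_mul he.le,
    show -(1 / p) * p = -1 by field_simp, Real.rpow_neg_one, ← one_div,
    le_div_iff₀ he, le_div_iff₀ (by positivity), mul_comm]

theorem rpow_one_sub_one_div {e : ℝ} (he : 0 < e) (p : ℝ) :
    e ^ (1 - 1 / p) = e ^ (-(1 / p)) * e := by
  rw [← Real.rpow_add_one he.ne']
  ring_nf

theorem setIntegral_indicator_const_add {μ : Measure X} [IsFiniteMeasure μ] {F : Set X}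
    (hF : MeasurableSet F) (c d : ℝ) (E : Set X) :
    ∫ x in E, (F.indicator (fun _ => c) x + d) ∂μ = c * μ.real (E ∩ F) + d * μ.real E := by
  rw [integral_add ((integrable_const c).indicator hF) (integrable_const d),
    setIntegral_indicator hF]
  simp [mul_comm]

theorem hasMoments_indicator_const_add {μ : Measure X} [IsProbabilityMeasure μ] {F : Set X}
    (hF : MeasurableSet F) {u v : ℝ} (hu : 0 ≤ u) (huv : u ≤ v) (q : ℝ) :
    HasMoments μ q (v * μ.real F + u * (1 - μ.real F)) (v ^ q * μ.real F + u ^ q * (1 - μ.real F))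
      (fun x => F.indicator (fun _ => v - u) x + u) := by
  have hpow : (fun x => (F.indicator (fun _ => v - u) x + u) ^ q) =
      fun x => F.indicator (fun _ => v ^ q - u ^ q) x + u ^ q := by
    funext x
    by_cases hx : x ∈ F <;> simp [hx]
  have hint : ∀ c d : ℝ, ∫ x, (F.indicator (fun _ => c) x + d) ∂μ = c * μ.real F + d := by
    intro c d
    have := setIntegral_indicator_const_add (μ := μ) hF c d Set.univ
    simpa using this
  have hi : ∀ c d : ℝ, Integrable (fun x => F.indicator (fun _ => c) x + d) μ := fun c d =>
    ((integrable_const c).indicator hF).add (integrable_const d)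
  refine ⟨(measurable_const.indicator hF).add_const u, fun x => ?_, hi _ _, ?_, hpow ▸ hi _ _, ?_⟩
  · exact add_nonneg (Set.indicator_nonneg (fun _ _ => sub_nonneg.2 huv) x) hu
  · rw [hint]; ring
  · rw [hpow, hint]; ring

/-- The weak type bound for a function with two values. -/
theorem setIntegral_indicator_const_add_le {μ : Measure X} [IsProbabilityMeasure μ] {F : Set X}
    (hF : MeasurableSet F) {u v p : ℝ} (hp : 1 < p) (huv : u ≤ v)
    (hF0 : 0 < μ.real F) (hF1 : μ.real F < 1) (hv : v ≤ μ.real F ^ (-(1 / p)))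
    (hmean : v * μ.real F + u * (1 - μ.real F) ≤ 1) (E : Set X) :
    ∫ x in E, (F.indicator (fun _ => v - u) x + u) ∂μ ≤ μ.real E ^ (1 - 1 / p) := by
  have h := one_div_mem_Ioo hp
  rw [setIntegral_indicator_const_add hF]
  have heb : μ.real (E ∩ F) ≤ μ.real E := measureReal_mono Set.inter_subset_left
  have hek : μ.real (E ∩ F) ≤ μ.real F := measureReal_mono Set.inter_subset_right
  have he0 : 0 ≤ μ.real (E ∩ F) := measureReal_nonneg
  have hb1 : μ.real E ≤ 1 := measureReal_le_one
  generalize μ.real (E ∩ F) = e at *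
  generalize μ.real E = b at *
  generalize μ.real F = k at *
  have huv' : 0 ≤ v - u := sub_nonneg.2 huv
  rcases (he0.trans heb).eq_or_lt with rfl | hb0
  · rw [le_antisymm heb he0, mul_zero, mul_zero, add_zero]
    exact Real.rpow_nonneg le_rfl _
  rcases le_total b k with hbk | hbk
  · calc (v - u) * e + u * b ≤ (v - u) * b + u * b := by gcongr
      _ = v * b := by ring
      _ ≤ b ^ (-(1 / p)) * b := by
          gcongr
          exact hv.trans (Real.rpow_le_rpow_of_nonpos hb0 hbk (by linarith [h.1]))
      _ = b ^ (1 - 1 / p) := (rpow_one_sub_one_div hb0 p).symm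
  · have hk1 : 0 < 1 - k := by linarith
    -- For `k ≤ b ≤ 1` the largest possible integral over a set of measure `b` is affine in `b`. It
    -- lies below the concave `b ^ (1 - 1 / p)` at `b = k` by `hv` and at `b = 1` by `hmean`, hence
    -- in between.
    obtain ⟨θ, hθ⟩ : ∃ θ, θ = (b - k) / (1 - k) := ⟨_, rfl⟩
    have hθ0 : 0 ≤ θ := hθ ▸ div_nonneg (by linarith) hk1.le
    have hθ1 : θ ≤ 1 := by rw [hθ, div_le_one hk1]; linarith
    have hb : b = (1 - θ) * k + θ * 1 := by rw [hθ]; field_simp; ring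
    have hconc := (Real.concaveOn_rpow (p := 1 - 1 / p) (by linarith [h.2])
      (by linarith [h.1])).2 (x := k) (y := 1) hF0.le (Set.mem_Ici.2 zero_le_one)
      (sub_nonneg.2 hθ1) hθ0 (by ring)
    simp only [smul_eq_mul, Real.one_rpow] at hconc
    rw [← hb] at hconc
    refine le_trans ?_ hconc
    have hvk : v * k ≤ k ^ (1 - 1 / p) := by
      rw [rpow_one_sub_one_div hF0]; gcongr
    calc (v - u) * e + u * b ≤ (v - u) * k + u * b := by gcongr
      _ = (1 - θ) * (v * k) + θ * (v * k + u * (1 - k)) := by rw [hb]; ring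
      _ ≤ (1 - θ) * k ^ (1 - 1 / p) + θ * 1 := by
          gcongr

/-- A function whose average over a set of measure at least `k` is at least `v` has a `q`-th moment
at least that of the two-valued function with the same integral and the value `v` on a set of
measure `k`. -/
theorem HasMoments.twoValued_rpow_le {μ : Measure X} [IsProbabilityMeasure μ] {q f A : ℝ}
    (hq : 1 < q) {φ : X → ℝ} (h : HasMoments μ q f A φ) {E : Set X} (hE : MeasurableSet E)
    {u v k : ℝ} (hu : 0 ≤ u) (huv : u ≤ v) (hk : 0 < k) (hkE : k ≤ μ.real E)
    (hvE : v * μ.real E ≤ ∫ x in E, φ x ∂μ) (hf : f = v * k + u * (1 - k)) :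
    v ^ q * k + u ^ q * (1 - k) ≤ A := by
  have hκ : 0 < μ.real E := hk.trans_le hkE
  -- On `E`, `φ ^ q` is bounded below by the tangents at `v` and `u` with weights `θ` and `1 - θ`,
  -- off `E` by the tangent at `u`. The weight makes the value `v` count with total mass `θ * μ.real
  -- E = k`.
  obtain ⟨θ, hθ⟩ : ∃ θ, θ = k / μ.real E := ⟨_, rfl⟩
  have hθ0 : 0 ≤ θ := hθ ▸ div_nonneg hk.le hκ.le
  have hθ1 : θ ≤ 1 := by rw [hθ, div_le_one hκ]; exact hkE
  have hθκ : θ * μ.real E = k := by rw [hθ]; field_simp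
  -- `c₀ + c₁ * φ` is the tangent at `v` minus the tangent at `u`. Its slope is nonnegative, so the
  -- lower bound on the average over `E` can be inserted.
  obtain ⟨c₀, hc₀⟩ : ∃ c, c = v ^ q - q * v ^ (q - 1) * v - (u ^ q - q * u ^ (q - 1) * u) :=
    ⟨_, rfl⟩
  obtain ⟨c₁, hc₁⟩ : ∃ c, c = q * (v ^ (q - 1) - u ^ (q - 1)) := ⟨_, rfl⟩
  have hc₁0 : 0 ≤ c₁ := hc₁ ▸ mul_nonneg (by linarith)
    (sub_nonneg.2 (Real.rpow_le_rpow hu huv (by linarith)))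
  have hi₀ : Integrable (fun x => q * u ^ (q - 1) * (φ x - u)) μ :=
    (h.integrable.sub (integrable_const u)).const_mul _
  have hi₁ : Integrable (fun x => u ^ q + q * u ^ (q - 1) * (φ x - u)) μ :=
    (integrable_const _).add hi₀
  have hi₂ : Integrable (fun x => θ * (c₀ + c₁ * φ x)) μ :=
    ((integrable_const c₀).add (h.integrable.const_mul c₁)).const_mul θ
  have hle : ∫ x, (u ^ q + q * u ^ (q - 1) * (φ x - u) +
      E.indicator (fun x => θ * (c₀ + c₁ * φ x)) x) ∂μ ≤ A := by
    rw [← h.integral_rpow_eq]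
    refine integral_mono (hi₁.add (hi₂.indicator hE)) h.integrable_rpow fun x => ?_
    have hL := rpow_add_mul_sub_le_rpow (hu.trans huv) (h.nonneg x) hq
    have hR := rpow_add_mul_sub_le_rpow hu (h.nonneg x) hq
    by_cases hx : x ∈ E
    · simp only [Set.indicator_of_mem hx]
      calc u ^ q + q * u ^ (q - 1) * (φ x - u) + θ * (c₀ + c₁ * φ x)
          = θ * (v ^ q + q * v ^ (q - 1) * (φ x - v)) +
            (1 - θ) * (u ^ q + q * u ^ (q - 1) * (φ x - u)) := by rw [hc₀, hc₁]; ring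
        _ ≤ θ * φ x ^ q + (1 - θ) * φ x ^ q := by
            gcongr
        _ = φ x ^ q := by ring
    · simpa only [Set.indicator_of_notMem hx, add_zero] using hR
  have hint₁ : ∫ x, (u ^ q + q * u ^ (q - 1) * (φ x - u)) ∂μ =
      u ^ q + q * u ^ (q - 1) * (f - u) := by
    rw [integral_add (integrable_const _) hi₀, integral_const_mul,
      integral_sub h.integrable (integrable_const u), h.integral_eq]
    simp
  have hint₂ : ∫ x in E, θ * (c₀ + c₁ * φ x) ∂μ =
      c₀ * k + c₁ * (θ * ∫ x in E, φ x ∂μ) := by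
    rw [integral_const_mul, integral_add (integrable_const _) (h.integrable.restrict.const_mul _),
      integral_const_mul, ← hθκ]
    simp
    ring
  rw [integral_add hi₁ (hi₂.indicator hE), integral_indicator hE, hint₁, hint₂] at hle
  have hs : v * k ≤ θ * ∫ x in E, φ x ∂μ := by
    calc v * k = θ * (v * μ.real E) := by rw [← hθκ]; ring
      _ ≤ _ := by gcongr
  have hs' := mul_le_mul_of_nonneg_left hs hc₁0
  refine le_trans (le_of_eq ?_) ((add_le_add_right (add_le_add_right hs' _) _).trans hle)
  rw [hc₀, hc₁, hf]
  ring

/-! ### The upper and lower bounds for the constrained supremum -/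

theorem div_le_maximalOp {μ : Measure X} {T : Set (Set X)} (φ : X → ℝ) {I : Set X} (hI : I ∈ T)
    {x : X} (hx : x ∈ I) : (∫⁻ y in I, ‖φ y‖ₑ ∂μ) / μ I ≤ maximalOp μ T φ x :=
  le_iSup_of_le I (le_iSup_of_le hI (le_iSup_of_le hx le_rfl))

/-- The weak type inequality in terms of real integrals. -/
theorem IsTreeWith.mul_measureReal_le_setIntegral {μ : Measure X} [IsProbabilityMeasure μ]
    {T : Set (Set X)} {C : Set X → Set (Set X)} (h : IsTreeWith μ T C) {φ : X → ℝ}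
    (hφ : Integrable φ μ) (h0 : ∀ x, 0 ≤ φ x) {l : ℝ} (hl : 0 < l) :
    l * μ.real {x | ENNReal.ofReal l ≤ maximalOp μ T φ x} ≤
      ∫ x in {x | ENNReal.ofReal l ≤ maximalOp μ T φ x}, φ x ∂μ := by
  have := h.mul_measure_le_maximalOp_le hφ (l := ENNReal.ofReal l) ENNReal.ofReal_ne_top
  rwa [setLIntegral_enorm_eq_ofReal hφ h0, ← ofReal_measureReal, ← ENNReal.ofReal_mul hl.le,
    ENNReal.ofReal_le_ofReal_iff (integral_nonneg h0)] at this

theorem IsTreeWith.measure_le_one_div_rpow {μ : Measure X} [IsProbabilityMeasure μ]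
    {T : Set (Set X)} {C : Set X → Set (Set X)} (h : IsTreeWith μ T C) {p : ℝ} (hp : 1 < p)
    {φ : X → ℝ} (hφ : Integrable φ μ) (h0 : ∀ x, 0 ≤ φ x) (hw : weakNorm μ p φ ≤ 1) {l : ℝ}
    (hl : 0 < l) :
    μ {x | ENNReal.ofReal l ≤ maximalOp μ T φ x} ≤ ENNReal.ofReal (1 / l ^ p) := by
  rw [← ofReal_measureReal]
  refine ENNReal.ofReal_le_ofReal ?_
  have h1 := (h.mul_measureReal_le_setIntegral hφ h0 hl).trans
    ((weakNorm_le_one_iff hp hφ h0).1 hw _ (h.measurable_maximalOp φ measurableSet_Ici))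
  rcases (measureReal_nonneg (μ := μ)
    (s := {x | ENNReal.ofReal l ≤ maximalOp μ T φ x})).eq_or_lt with he | he
  · rw [← he]; positivity
  · change l * _ ≤ μ.real {x | ENNReal.ofReal l ≤ maximalOp μ T φ x} ^ _ at h1
    rw [rpow_one_sub_one_div he] at h1
    exact (le_rpow_neg_one_div_iff he hl (by linarith)).1 (le_of_mul_le_mul_right h1 he)

/-- A lower bound for the constrained supremum: it suffices to find an almost disjoint family in the
tree and an admissible function with small `q`-th moment whose averages over the family are
large. -/
theorem IsTreeWith.measure_sUnion_le_supT {μ : Measure X} [IsProbabilityMeasure μ]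
    {T : Set (Set X)} {C : Set X → Set (Set X)} (h : IsTreeWith μ T C) {p q : ℝ} (hq : 1 < q)
    (hqp : q < p) {f A A₀ l : ℝ} (hf : 0 < f) (hf1 : f ≤ 1)
    (hA : A ≤ gammaConst p q * f ^ ((p - q) / (p - 1))) {S : Set (Set X)} (hS : S ⊆ T)
    (hSd : S.Pairwise (AEDisjoint μ)) (hk : 0 < μ.real (⋃₀ S)) (hlf : l * μ.real (⋃₀ S) ≤ f)
    (hlk : l ≤ μ.real (⋃₀ S) ^ (-(1 / p))) {φ₀ : X → ℝ} (hφ₀ : HasMoments μ q f A₀ φ₀)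
    (hA₀ : A₀ ≤ A) (hw₀ : ∀ E, MeasurableSet E → ∫ x in E, φ₀ x ∂μ ≤ μ.real E ^ (1 - 1 / p))
    (hl₀ : ∀ I ∈ S, l * μ.real I ≤ ∫ x in I, φ₀ x ∂μ) :
    μ (⋃₀ S) ≤ supT μ T p q f A l := by
  have hp : 1 < p := hq.trans hqp
  have hp1 : 0 < p - 1 := by linarith
  obtain ⟨g, hg, hg0⟩ := h.exists_measurable_null_fibers
  obtain ⟨U, hU, hUμ, hUS⟩ := exists_uniform_on_family hg hg0 (h.countable.mono hS)
    (fun I hI => h.measurableSet I (hS hI)) hSd hk (ofReal_measureReal (by finiteness)).symm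
  have hφ₁ := hasMoments_truncatedPower_comp hU hUμ hq hqp hf hf1
  set a := f ^ (p / (p - 1)) with ha
  have ha0 : 0 ≤ a := by positivity
  set k := μ.real (⋃₀ S)
  have hl₁ : ∀ I ∈ S, l * μ.real I ≤ ∫ x in I, truncatedPower p a (U x) ∂μ := by
    intro I hI
    rw [setIntegral_truncatedPower_comp hU hp ha0 hk (hUS I hI)]
    -- If `k ≤ a`, the profile has average `k ^ (-(1 / p)) ≥ l` over `(0, k]`. If `a ≤ k`, its whole
    -- mass `f ≥ l * k` lies there.
    have hmin : l * k ≤ (min k a) ^ (1 - 1 / p) := by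
      rcases le_total k a with hka | hka
      · rw [min_eq_left hka, rpow_one_sub_one_div hk]
        gcongr
      · rwa [min_eq_right hka, ha, ← Real.rpow_mul hf.le,
          show p / (p - 1) * (1 - 1 / p) = 1 by field_simp, Real.rpow_one]
    calc l * μ.real I = μ.real I / k * (l * k) := by field_simp
      _ ≤ _ := by gcongr
  obtain ⟨s, hs, hφ⟩ := hφ₀.exists_between hq hφ₁ hA₀ hA
  have hs1 : 0 ≤ 1 - s := sub_nonneg.2 hs.2
  have hsplit : ∀ E : Set X, ∫ x in E, ((1 - s) * φ₀ x + s * truncatedPower p a (U x)) ∂μ =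
      (1 - s) * ∫ x in E, φ₀ x ∂μ + s * ∫ x in E, truncatedPower p a (U x) ∂μ := fun E => by
    rw [integral_add (hφ₀.integrable.restrict.const_mul _) (hφ₁.integrable.restrict.const_mul _),
      integral_const_mul, integral_const_mul]
  have hw : weakNorm μ p (fun x => (1 - s) * φ₀ x + s * truncatedPower p a (U x)) ≤ 1 := by
    rw [weakNorm_le_one_iff hp hφ.integrable hφ.nonneg]
    intro E hE
    rw [hsplit]
    calc _ ≤ (1 - s) * μ.real E ^ (1 - 1 / p) + s * μ.real E ^ (1 - 1 / p) :=
          add_le_add (mul_le_mul_of_nonneg_left (hw₀ E hE) hs1)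
            (mul_le_mul_of_nonneg_left (setIntegral_truncatedPower_comp_le hU hUμ hp ha0 E) hs.1)
      _ = _ := by ring
  refine le_trans (measure_mono ?_) (le_iSup₂_of_le _ hφ (le_iSup_of_le hw le_rfl))
  rintro x ⟨I, hI, hx⟩
  refine le_trans ?_ (div_le_maximalOp _ (hS hI) hx)
  rw [ENNReal.le_div_iff_mul_le (Or.inl (h.measure_pos I (hS hI)).ne')
    (Or.inl (measure_ne_top μ I)), setLIntegral_enorm_eq_ofReal hφ.integrable hφ.nonneg,
    ← ofReal_measureReal (μ := μ) (s := I), ← ENNReal.ofReal_mul' measureReal_nonneg]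
  refine ENNReal.ofReal_le_ofReal ?_
  rw [hsplit]
  calc l * μ.real I = (1 - s) * (l * μ.real I) + s * (l * μ.real I) := by ring
    _ ≤ _ := add_le_add (mul_le_mul_of_nonneg_left (hl₀ I hI) hs1)
      (mul_le_mul_of_nonneg_left (hl₁ I hI) hs.1)

theorem IsTreeWith.one_le_supT_of_le {μ : Measure X} [IsProbabilityMeasure μ]
    {T : Set (Set X)} {C : Set X → Set (Set X)} (h : IsTreeWith μ T C) {p q : ℝ} (hq : 1 < q)
    (hqp : q < p) {f A l : ℝ} (hfA : (f, A) ∈ domainD p q) (hlf : l ≤ f) :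
    1 ≤ supT μ T p q f A l := by
  obtain ⟨hf, hf1, hA₀, hA⟩ := hfA
  simp only at hf hf1 hA₀ hA
  have hp : 1 < p := hq.trans hqp
  have hp' := one_div_mem_Ioo hp
  have hφ₀ : HasMoments μ q f (f ^ q) fun _ => f :=
    ⟨measurable_const, fun _ => hf.le, integrable_const _, by simp, integrable_const _, by simp⟩
  -- The family is `{X}`, with `k = 1`; the constant `f` has the least `q`-th moment `f ^ q`, and
  -- its norm is at most 1 because `f ≤ 1`.
  have := h.measure_sUnion_le_supT hq hqp (l := l) hf hf1 hA (S := {Set.univ})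
    (by simpa using h.univ_mem) (Set.pairwise_singleton _ _) (by simp) (by simpa using hlf)
    (by simpa using hlf.trans hf1) hφ₀ hA₀ (fun E _ => by
      have hb : μ.real E ≤ 1 := measureReal_le_one
      have hb0 : 0 ≤ μ.real E := measureReal_nonneg
      rw [setIntegral_const, smul_eq_mul]
      calc μ.real E * f ≤ μ.real E * 1 := by gcongr
        _ = μ.real E ^ (1 : ℝ) := by rw [mul_one, Real.rpow_one]
        _ ≤ _ := by
          rcases hb0.eq_or_lt with hb0 | hb0
          · rw [← hb0, Real.zero_rpow one_ne_zero]; exact Real.rpow_nonneg le_rfl _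
          · exact Real.rpow_le_rpow_of_exponent_ge hb0 hb (by linarith [hp'.1]))
    (by simpa using hlf)
  simpa using this

theorem IsTreeWith.min_le_supT_of_lt {μ : Measure X} [IsProbabilityMeasure μ]
    {T : Set (Set X)} {C : Set X → Set (Set X)} (h : IsTreeWith μ T C) {p q : ℝ} (hq : 1 < q)
    (hqp : q < p) {f A l : ℝ} (hfA : (f, A) ∈ domainD p q) (hfl : f < l) :
    min (supG μ T q f A l) (ENNReal.ofReal (1 / l ^ p)) ≤ supT μ T p q f A l := by
  obtain ⟨hf, hf1, -, hA⟩ := hfA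
  simp only at hf hf1 hA
  have hp : 1 < p := hq.trans hqp
  have hl : 0 < l := hf.trans hfl
  refine le_of_forall_lt fun c hc => ?_
  obtain ⟨hcG, hcl⟩ := lt_min_iff.1 hc
  simp only [supG, lt_iSup_iff] at hcG
  obtain ⟨φ, hφ, hcφ⟩ := hcG
  set E := {x | ENNReal.ofReal l ≤ maximalOp μ T φ x} with hEdef
  have hE : MeasurableSet E := h.measurable_maximalOp φ measurableSet_Ici
  have hlE : l * μ.real E ≤ ∫ x in E, φ x ∂μ :=
    h.mul_measureReal_le_setIntegral hφ.integrable hφ.nonneg hl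
  have hEf : l * μ.real E ≤ f := hlE.trans (hφ.integral_eq ▸
    setIntegral_le_integral hφ.integrable (Eventually.of_forall hφ.nonneg))
  obtain ⟨S, hS, hSd, hcS, hSle⟩ := h.exists_family_measure_mem_Ioc (lt_min hcφ hcl)
    (min_le_of_left_le prob_le_one)
  have hSm : MeasurableSet (⋃₀ S) :=
    MeasurableSet.sUnion (h.countable.mono hS) fun I hI => h.measurableSet I (hS hI)
  refine hcS.trans_le ?_
  have hk : 0 < μ.real (⋃₀ S) := ENNReal.toReal_pos (zero_le.trans_lt hcS).ne' (measure_ne_top _ _)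
  have hkE : μ.real (⋃₀ S) ≤ μ.real E :=
    ENNReal.toReal_mono (measure_ne_top _ _) (hSle.trans (min_le_left _ _))
  have hkl : μ.real (⋃₀ S) ≤ 1 / l ^ p :=
    ENNReal.toReal_le_of_le_ofReal (by positivity) (hSle.trans (min_le_right _ _))
  -- In this form the bound `1 / l ^ p` serves both functions: it controls the norm of the
  -- two-valued one and the averages of the truncated power.
  have hlk := (le_rpow_neg_one_div_iff hk hl (by linarith)).2 hkl
  have hkf : l * μ.real (⋃₀ S) ≤ f := (mul_le_mul_of_nonneg_left hkE hl.le).trans hEf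
  have hk1 : μ.real (⋃₀ S) < 1 := by
    by_contra hcon
    nlinarith
  -- The value off `⋃₀ S` that makes the mean `f`. It is nonnegative since `l * k ≤ f`, and at most
  -- `l` since `f < l`.
  obtain ⟨u, hu⟩ : ∃ u, u = (f - l * μ.real (⋃₀ S)) / (1 - μ.real (⋃₀ S)) := ⟨_, rfl⟩
  have hu0 : 0 ≤ u := hu ▸ div_nonneg (sub_nonneg.2 hkf) (sub_nonneg.2 hk1.le)
  have hul : u ≤ l := by
    rw [hu, div_le_iff₀ (sub_pos.2 hk1)]
    linarith
  have hmean : f = l * μ.real (⋃₀ S) + u * (1 - μ.real (⋃₀ S)) := by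
    rw [hu, div_mul_cancel₀ _ (sub_pos.2 hk1).ne']
    ring
  have hφ₀ := hasMoments_indicator_const_add (μ := μ) hSm hu0 hul q
  rw [← hmean] at hφ₀
  refine h.measure_sUnion_le_supT hq hqp hf hf1 hA hS hSd hk hkf hlk hφ₀
    (hφ.twoValued_rpow_le hq hE hu0 hul hk hkE hlE hmean) (fun F _ =>
      setIntegral_indicator_const_add_le hSm hp hul hk hk1 hlk (hmean ▸ hf1) F) fun I hI => ?_
  rw [setIntegral_indicator_const_add hSm, Set.inter_eq_left.2 (Set.subset_sUnion_of_mem hI)]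
  exact le_of_eq (by ring)

end DyadicMaximal

theorem theorem4p1 {X : Type*} [MeasurableSpace X] (μ : Measure X) [IsProbabilityMeasure μ]
    (hμ : DyadicMaximal.IsNonatomic μ) (T : Set (Set X)) (hT : DyadicMaximal.IsTree μ T)
    (p q : ℝ) (hq : 1 < q) (hqp : q < p)
    (f A : ℝ) (hfA : (f, A) ∈ DyadicMaximal.domainD p q) (lam : ℝ) (hlam : 0 < lam) :
    DyadicMaximal.supT μ T p q f A lam =
      min 1 (min (DyadicMaximal.supG μ T q f A lam) (ENNReal.ofReal (1 / lam ^ p))) := by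
  obtain ⟨C, h⟩ := hT
  refine le_antisymm (iSup_le fun φ => iSup₂_le fun hφ hw => ?_) ?_
  · refine le_min prob_le_one (le_min ?_ ?_)
    · exact le_iSup₂_of_le φ hφ le_rfl
    · exact h.measure_le_one_div_rpow (hq.trans hqp) hφ.integrable hφ.nonneg hw hlam
  · rcases le_or_gt lam f with hlf | hlf
    · exact (min_le_left _ _).trans (h.one_le_supT_of_le hq hqp hfA hlf)
    · exact (min_le_right _ _).trans (h.min_le_supT_of_lt hq hqp hfA hlf)
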